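/- For an integer $k\ge 1$, let $F_k$ be the friendship graph, that is, the graph on $2k+1$ vertices consisting of $k$ triangles that share exactly one common vertex. Let $G$ be a finite simple graph on $n$ vertices that is $F_k$-free, i.e. $G$ has no (not necessarily induced) subgraph isomorphic to $F_k$. Let $e(G)$ denote the number of edges, $\delta(G)$ and $\Delta(G)$ the minimum and maximum degree, and $\lambda(G)$ the spectral radius of the adjacency matrix of $G$ (the maximum modulus of its eigenvalues); for $S\subseteq V(G)$ let $e(S)$ be the number of edges of $G$ with both endpoints in $S$. Suppose that $\lambda(G)\ge n/2$. Then \[ e(G) > \frac{n^2}{4} - 54k^2, \] and there exists a vertex partition $V(G)=S\cup T$ (with $S\cap T=\emptyset$) such that \[ e(S)+e(T) < 108k^2, \qquad \frac n2 - 13k < |S| < \frac n2 + 13k, \qquad \frac n2 - 13k < |T| < \frac n2+13k. \] Moreover, \[ \frac n2 - 56k^2 < \delta(G) \le \lambda(G) \le \Delta(G) < \frac n2 + 14k. \] -/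

import Mathlib

/-- The friendship graph: `k` triangles sharing exactly one vertex. The common vertex is `none`, and
the `i`-th triangle has vertices `none`, `some (i, false)`, `some (i, true)`. -/
def friendshipGraph (k : ℕ) : SimpleGraph (Option (Fin k × Bool)) where
  Adj
    | none, none => False
    | none, some _ => True
    | some _, none => True
    | some (i, a), some (j, b) => i = j ∧ a ≠ b
  symm := ⟨by
    rintro (_ | ⟨i, a⟩) (_ | ⟨j, b⟩) h
    · exact h
    · trivial
    · trivial
    · exact ⟨h.1.symm, h.2.symm⟩⟩
  loopless := ⟨by
    rintro (_ | ⟨i, a⟩) h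
    · exact h
    · exact h.2 rfl⟩

/-- The adjacency spectral radius of a finite graph: the maximum modulus of an eigenvalue of the
adjacency matrix. This matrix is real symmetric, so its eigenvalues are all real; there are finitely
many of them, so the supremum in Mathlib's `spectralRadius` is finite. -/
noncomputable def SimpleGraph.adjSpectralRadius {V : Type*} [Fintype V] [DecidableEq V]
    (G : SimpleGraph V) [DecidableRel G.Adj] : ℝ :=
  (spectralRadius ℝ (G.adjMatrix ℝ)).toReal

/-- `e(S)`: the number of edges of `G` with both endpoints in `S`. -/
def SimpleGraph.edgesWithin {V : Type*} [DecidableEq V]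
    (G : SimpleGraph V) [DecidableRel G.Adj] (S : Finset V) : ℕ :=
  (G.induce (S : Set V)).edgeFinset.card

/-! In an $F_k$-free graph no neighbourhood contains $k$ disjoint edges, so at most $2k$ vertices
cover its edges. This forces at most $36k^2n$ ordered triangles (`orderedTriangles_le`), and
everything else measures how close this makes $G$ to balanced complete bipartite.

With $\mu=\lambda(G)$, comparing traces of $A^2$ and $A^3$ gives $e\ge\mu^2-36k^2\ge n^2/4-36k^2$; a
Moon–Moser count gives $e\le n^2/4+18k^2$. Averaging the partitions $N(v)\cup N(v)^c$ over $v$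
yields one with at most $72k^2$ inner edges, hence at least $n^2/4-108k^2$ crossing edges, which
forces balance. Deleting a vertex of minimum degree bounds $\delta$ from below; a vertex of too
large degree would have many neighbours on both sides, and $F_k$-freeness would then remove too many
crossing edges. -/

open Finset

/-! ### Matchings and covers in neighbourhoods -/

/-- There are `k` pairwise disjoint pairs of points, each of them related by `r`. -/
def HasDisjointPairs {V : Type*} (r : V → V → Prop) (k : ℕ) : Prop :=
  ∃ f : ℕ × Bool → V, Set.InjOn f {p | p.1 < k} ∧ ∀ i < k, r (f (i, false)) (f (i, true))

theorem HasDisjointPairs.succ {V : Type*} {r : V → V → Prop} {k : ℕ} {f : ℕ × Bool → V}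
    (hf : Set.InjOn f {p | p.1 < k}) (hr : ∀ i < k, r (f (i, false)) (f (i, true)))
    {x y : V} (hxy : r x y) (hne : x ≠ y) (hx : ∀ i < k, ∀ b, f (i, b) ≠ x)
    (hy : ∀ i < k, ∀ b, f (i, b) ≠ y) : HasDisjointPairs r (k + 1) := by
  classical
  refine ⟨fun p => if p.1 = k then (if p.2 then y else x) else f p, ?_, ?_⟩
  · rintro ⟨i, a⟩ hi ⟨j, b⟩ hj h
    simp only [Set.mem_ofPred_eq] at hi hj
    by_cases h1 : i = k <;> by_cases h2 : j = k
    · subst h1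
      subst h2
      cases a <;> cases b <;> simp_all
    · have hjk : j < k := by omega
      cases a <;> simp [h1, h2] at h
      · exact absurd h.symm (hx j hjk b)
      · exact absurd h.symm (hy j hjk b)
    · have hik : i < k := by omega
      cases b <;> simp [h1, h2] at h
      · exact absurd h (hx i hik a)
      · exact absurd h (hy i hik a)
    · simp only [h1, h2, if_false] at h
      exact hf (show i < k by omega) (show j < k by omega) h
  · intro i hi
    by_cases h1 : i = k
    · simpa [h1] using hxy
    · simpa [h1] using hr i (by omega)

/-- If there are no `k` disjoint related pairs, then few points meet all related pairs. -/
theorem exists_cover_of_not_hasDisjointPairs {V : Type*} {r : V → V → Prop}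
    (hirr : ∀ x, ¬ r x x) {k : ℕ} (h : ¬ HasDisjointPairs r k) :
    ∃ A B : Finset V, A.card ≤ k ∧ B.card ≤ k ∧ (∀ x ∈ A, ∃ y, r x y) ∧ (∀ y ∈ B, ∃ x, r x y) ∧
      ∀ x y, r x y → x ∈ A ∨ x ∈ B ∨ y ∈ A ∨ y ∈ B := by
  classical
  induction k with
  | zero =>
    -- If `V` is empty there is no map `f` at all, so the property fails even for zero pairs.
    rcases isEmpty_or_nonempty V with hV | ⟨⟨v⟩⟩
    · exact ⟨∅, ∅, by simp, by simp, by simp, by simp, fun x => hV.elim x⟩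
    · exact absurd ⟨fun _ => v, by simp [Set.InjOn], by simp⟩ h
  | succ k ih =>
    by_cases hk : HasDisjointPairs r k
    · obtain ⟨f, hf, hr⟩ := hk
      -- A family of `k` pairs is maximal here, so its endpoints meet every pair. First and second
      -- endpoints are kept apart for the bipartite use, where they lie on different sides.
      refine ⟨(range k).image fun i => f (i, false), (range k).image fun i => f (i, true),
        card_image_le.trans (by simp), card_image_le.trans (by simp), ?_, ?_, ?_⟩
      · intro x hx
        obtain ⟨i, hi, rfl⟩ := mem_image.1 hx
        exact ⟨_, hr i (mem_range.1 hi)⟩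
      · intro x hx
        obtain ⟨i, hi, rfl⟩ := mem_image.1 hx
        exact ⟨_, hr i (mem_range.1 hi)⟩
      · intro x y hxy
        by_contra! hcon
        obtain ⟨h1, h2, h3, h4⟩ := hcon
        simp only [mem_image, mem_range, not_exists, not_and] at h1 h2 h3 h4
        refine h (HasDisjointPairs.succ hf hr hxy (fun e => hirr x (e ▸ hxy)) ?_ ?_)
        · rintro i hi (_ | _)
          exacts [h1 i hi, h2 i hi]
        · rintro i hi (_ | _)
          exacts [h3 i hi, h4 i hi]
    · obtain ⟨A, B, hA, hB, h'⟩ := ih hk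
      exact ⟨A, B, hA.trans k.le_succ, hB.trans k.le_succ, h'⟩

/-- In a graph without friendship subgraph there are no `k` disjoint edges in a neighbourhood. -/
theorem not_hasDisjointPairs_of_free {V : Type*} {G : SimpleGraph V} {k : ℕ}
    (hfree : (friendshipGraph k).Free G) (v : V) {r : V → V → Prop}
    (hr : ∀ x y, r x y → G.Adj v x ∧ G.Adj v y ∧ G.Adj x y) : ¬ HasDisjointPairs r k := by
  rintro ⟨f, hf, hfr⟩
  have hv : ∀ i < k, ∀ b, G.Adj v (f (i, b)) := by
    rintro i hi (_ | _)
    exacts [(hr _ _ (hfr i hi)).1, (hr _ _ (hfr i hi)).2.1]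
  let g : Option (Fin k × Bool) → V := fun o => o.elim v fun p => f (p.1, p.2)
  refine hfree ⟨⟨⟨g, ?_⟩, ?_⟩⟩
  · rintro (_ | ⟨i, a⟩) (_ | ⟨j, b⟩) hab
    · exact hab.elim
    · exact hv j j.2 b
    · exact (hv i i.2 a).symm
    · obtain ⟨rfl, hne⟩ := hab
      have := (hr _ _ (hfr i i.2)).2.2
      cases a <;> cases b
      exacts [absurd rfl hne, this, this.symm, absurd rfl hne]
  · rintro (_ | ⟨i, a⟩) (_ | ⟨j, b⟩) hab
    · rfl
    · exact absurd hab (hv j j.2 b).ne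
    · exact absurd hab (hv i i.2 a).ne'
    · have := hf (show (i : ℕ) < k from i.2) (show (j : ℕ) < k from j.2) hab
      simp only [Prod.mk.injEq, Fin.val_inj] at this
      simp [this.1, this.2]

theorem exists_neighborFinset_cover {V : Type*} [Fintype V] [DecidableEq V] {G : SimpleGraph V}
    {k : ℕ} (hfree : (friendshipGraph k).Free G) (v : V) :
    ∃ C : Finset V, C.card ≤ 2 * k ∧
      ∀ x y, G.Adj v x → G.Adj v y → G.Adj x y → x ∈ C ∨ y ∈ C := by
  obtain ⟨A, B, hA, hB, -, -, h⟩ := exists_cover_of_not_hasDisjointPairs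
    (r := fun x y => G.Adj v x ∧ G.Adj v y ∧ G.Adj x y) (fun x hx => hx.2.2.ne rfl)
    (not_hasDisjointPairs_of_free hfree v fun _ _ h => h)
  refine ⟨A ∪ B, (card_union_le A B).trans (by omega), fun x y h1 h2 h3 => ?_⟩
  simpa [or_assoc] using h x y ⟨h1, h2, h3⟩

/-! ### Counting triangles -/

/-- The number of ordered pairs of adjacent neighbours of `c`, such that the edges to `c` are both
in many triangles or both in few triangles. -/
theorem card_balanced_pairs_le {V : Type*} [Fintype V] [DecidableEq V] {G : SimpleGraph V}
    [DecidableRel G.Adj] {k : ℕ} (hfree : (friendshipGraph k).Free G) (c : V) :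
    ((univ : Finset (V × V)).filter fun p => G.Adj c p.1 ∧ G.Adj c p.2 ∧ G.Adj p.1 p.2 ∧
      ((G.neighborFinset c ∩ G.neighborFinset p.1).card ≤ 2 * k ↔
        (G.neighborFinset c ∩ G.neighborFinset p.2).card ≤ 2 * k)).card ≤ 12 * k ^ 2 := by
  obtain ⟨C, hC, hcov⟩ := exists_neighborFinset_cover hfree c
  set N : V → Finset V := fun x => G.neighborFinset c ∩ G.neighborFinset x with hN
  -- If `x` is outside the cover `C`, all common neighbours of `c` and `x` lie in `C`, so there are
  -- at most `2 * k`.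
  have hheavy : ∀ x, G.Adj c x → ¬ (N x).card ≤ 2 * k → x ∈ C := by
    intro x hx hcard
    by_contra hxC
    refine hcard ((card_le_card fun y hy => ?_).trans hC)
    simp only [hN, mem_inter, SimpleGraph.mem_neighborFinset] at hy
    exact (hcov x y hx hy.1 hy.2).resolve_left hxC
  set L := C.filter fun x => (N x).card ≤ 2 * k with hL
  have hLcard : L.card ≤ 2 * k := (card_filter_le _ _).trans hC
  set P₁ := L.biUnion fun x => (N x).image fun y => (x, y) with hP₁
  set P₂ := L.biUnion fun x => (N x).image fun y => (y, x) with hP₂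
  have h1 : P₁.card ≤ 2 * k * (2 * k) :=
    (card_biUnion_le_card_mul _ _ (2 * k) fun x hx =>
      card_image_le.trans (mem_filter.1 hx).2).trans (Nat.mul_le_mul_right _ hLcard)
  have h2 : P₂.card ≤ 2 * k * (2 * k) :=
    (card_biUnion_le_card_mul _ _ (2 * k) fun x hx =>
      card_image_le.trans (mem_filter.1 hx).2).trans (Nat.mul_le_mul_right _ hLcard)
  have h3 : (C ×ˢ C).card ≤ 2 * k * (2 * k) := by
    rw [card_product]
    exact Nat.mul_le_mul hC hC
  refine (card_le_card (t := C ×ˢ C ∪ (P₁ ∪ P₂)) ?_).trans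
    (((card_union_le _ _).trans (Nat.add_le_add_left (card_union_le _ _) _)).trans (by nlinarith))
  rintro ⟨x, y⟩ hp
  obtain ⟨hx, hy, hxy, hiff⟩ := (mem_filter.1 hp).2
  by_cases hlx : (N x).card ≤ 2 * k
  · have hly := hiff.1 hlx
    rcases hcov x y hx hy hxy with h | h
    · refine mem_union_right _ (mem_union_left _ (mem_biUnion.2 ⟨x, mem_filter.2 ⟨h, hlx⟩, ?_⟩))
      exact mem_image_of_mem _ (by simp [hN, hy, hxy])
    · refine mem_union_right _ (mem_union_right _ (mem_biUnion.2 ⟨y, mem_filter.2 ⟨h, hly⟩, ?_⟩))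
      exact mem_image.2 ⟨x, by simp [hN, hx, hxy.symm], rfl⟩
  · exact mem_union_left _ (mem_product.2 ⟨hheavy x hx hlx, hheavy y hy (mt hiff.2 hlx)⟩)

/-- The number of ordered triangles of `G`. -/
noncomputable def SimpleGraph.orderedTriangles {V : Type*} [Fintype V] (G : SimpleGraph V)
    [DecidableRel G.Adj] : ℝ :=
  ∑ u, ∑ v, ∑ w, G.adjMatrix ℝ u v * G.adjMatrix ℝ v w * G.adjMatrix ℝ w u

/-- Call an edge light if it is in at most $2k$ triangles, heavy otherwise. Two of the three edges
of a triangle have the same type; charge the triangle to their common vertex. Each ordered triangle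
is thus counted at one of three apexes, each sum being at most $12k^2n$. -/
theorem orderedTriangles_le {V : Type*} [Fintype V] [DecidableEq V] {G : SimpleGraph V}
    [DecidableRel G.Adj] {k : ℕ} (hfree : (friendshipGraph k).Free G) :
    G.orderedTriangles ≤ 36 * k ^ 2 * Fintype.card V := by
  let R : V → V → V → ℝ := fun c x y => if G.Adj c x ∧ G.Adj c y ∧ G.Adj x y ∧
      ((G.neighborFinset c ∩ G.neighborFinset x).card ≤ 2 * k ↔
        (G.neighborFinset c ∩ G.neighborFinset y).card ≤ 2 * k) then 1 else 0
  have hR : ∑ c, ∑ x, ∑ y, R c x y ≤ 12 * k ^ 2 * Fintype.card V := by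
    have hc : ∀ c, ∑ x, ∑ y, R c x y ≤ 12 * k ^ 2 := by
      intro c
      rw [← Fintype.sum_prod_type']
      simp only [R, sum_boole]
      exact_mod_cast card_balanced_pairs_le hfree c
    calc _ ≤ ∑ _c : V, (12 * k ^ 2 : ℝ) := sum_le_sum fun c _ => hc c
      _ = _ := by simp [mul_comm]
  have hpt : ∀ u v w, G.adjMatrix ℝ u v * G.adjMatrix ℝ v w * G.adjMatrix ℝ w u ≤
      R u v w + R v w u + R w u v := by
    intro u v w
    have h0 : ∀ c x y, 0 ≤ R c x y := fun c x y => by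
      simp only [R]
      split_ifs <;> norm_num
    by_cases h1 : G.Adj u v; swap
    · simpa [h1] using add_nonneg (add_nonneg (h0 _ _ _) (h0 _ _ _)) (h0 _ _ _)
    by_cases h2 : G.Adj v w; swap
    · simpa [h2] using add_nonneg (add_nonneg (h0 _ _ _) (h0 _ _ _)) (h0 _ _ _)
    by_cases h3 : G.Adj w u; swap
    · simpa [h3] using add_nonneg (add_nonneg (h0 _ _ _) (h0 _ _ _)) (h0 _ _ _)
    have key : R u v w = 1 ∨ R v w u = 1 ∨ R w u v = 1 := by
      have c1 := inter_comm (G.neighborFinset v) (G.neighborFinset u)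
      have c2 := inter_comm (G.neighborFinset w) (G.neighborFinset v)
      have c3 := inter_comm (G.neighborFinset u) (G.neighborFinset w)
      simp only [R, h1, h2, h3, h1.symm, h2.symm, h3.symm, true_and, c1, c2, c3]
      by_cases p : (G.neighborFinset u ∩ G.neighborFinset v).card ≤ 2 * k <;>
      by_cases q : (G.neighborFinset v ∩ G.neighborFinset w).card ≤ 2 * k <;>
      by_cases r : (G.neighborFinset w ∩ G.neighborFinset u).card ≤ 2 * k <;>
      simp [p, q, r]
    have hl : G.adjMatrix ℝ u v * G.adjMatrix ℝ v w * G.adjMatrix ℝ w u = 1 := by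
      simp [h1, h2, h3]
    have := h0 u v w
    have := h0 v w u
    have := h0 w u v
    rcases key with h | h | h <;> linarith
  have e1 : ∑ u, ∑ v, ∑ w, R v w u = ∑ c, ∑ x, ∑ y, R c x y := by
    rw [sum_comm]
    exact sum_congr rfl fun v _ => sum_comm
  have e2 : ∑ u, ∑ v, ∑ w, R w u v = ∑ c, ∑ x, ∑ y, R c x y := by
    rw [← e1, sum_comm]
    rw [sum_comm]
    refine Eq.trans (sum_congr rfl fun v _ => sum_comm) ?_
    rw [sum_comm, ← e1]
  calc G.orderedTriangles ≤ ∑ u, ∑ v, ∑ w, (R u v w + R v w u + R w u v) :=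
        sum_le_sum fun u _ => sum_le_sum fun v _ => sum_le_sum fun w _ => hpt u v w
    _ = 3 * ∑ c, ∑ x, ∑ y, R c x y := by
        simp only [sum_add_distrib]
        rw [e1, e2]
        ring
    _ ≤ _ := by linarith

/-! ### Eigenvalues and the spectral radius -/

theorem Matrix.IsHermitian.trace_pow_eq_sum {V : Type*} [Fintype V] [DecidableEq V]
    {A : Matrix V V ℝ} (hA : A.IsHermitian) (m : ℕ) :
    (A ^ m).trace = ∑ i, hA.eigenvalues i ^ m := by
  conv_lhs => rw [hA.spectral_theorem, ← map_pow, Unitary.conjStarAlgAut_apply,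
    Matrix.trace_mul_comm, ← mul_assoc, Unitary.coe_star_mul_self, one_mul, Matrix.diagonal_pow]
  simp [Matrix.trace]

theorem Matrix.IsHermitian.dotProduct_mulVec_le {V : Type*} [Fintype V] [DecidableEq V]
    {A : Matrix V V ℝ} (hA : A.IsHermitian) {M : ℝ} (hM : ∀ i, hA.eigenvalues i ≤ M) (x : V → ℝ) :
    x ⬝ᵥ A.mulVec x ≤ M * (x ⬝ᵥ x) := by
  have hps : (algebraMap ℝ (Matrix V V ℝ) M - A).PosSemidef := by
    rw [Matrix.posSemidef_iff_isHermitian_and_spectrum_nonneg]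
    constructor
    · refine Matrix.IsHermitian.sub ?_ hA
      rw [Matrix.algebraMap_eq_diagonal]
      exact Matrix.isHermitian_diagonal _
    · rw [← spectrum.singleton_sub_eq, hA.spectrum_real_eq_range_eigenvalues]
      rintro _ ⟨_, rfl, _, ⟨i, rfl⟩, rfl⟩
      simpa using hM i
  have := hps.dotProduct_mulVec_nonneg x
  rw [Matrix.sub_mulVec, dotProduct_sub, Algebra.algebraMap_eq_smul_one, Matrix.smul_mulVec,
    Matrix.one_mulVec, dotProduct_smul] at this
  simp at this
  linarith

theorem Matrix.IsHermitian.exists_dotProduct_mulVec_eq_eigenvalue {V : Type*} [Fintype V]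
    [DecidableEq V] {A : Matrix V V ℝ} (hA : A.IsHermitian) (j : V) :
    ∃ y : V → ℝ, y ⬝ᵥ y = 1 ∧ y ⬝ᵥ A.mulVec y = hA.eigenvalues j := by
  have hyy : ⇑(hA.eigenvectorBasis j) ⬝ᵥ ⇑(hA.eigenvectorBasis j) = 1 := by
    have h2 : inner ℝ (hA.eigenvectorBasis j) (hA.eigenvectorBasis j) = (1 : ℝ) := by
      rw [real_inner_self_eq_norm_sq, hA.eigenvectorBasis.orthonormal.1 j, one_pow]
    rw [← h2, PiLp.inner_apply]
    simp only [dotProduct, RCLike.inner_apply, conj_trivial]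
  exact ⟨_, hyy, by
    rw [hA.mulVec_eigenvectorBasis j, dotProduct_smul, hyy, smul_eq_mul, mul_one]⟩

namespace SimpleGraph

variable {V : Type*} [Fintype V] (G : SimpleGraph V) [DecidableRel G.Adj]

theorem dotProduct_adjMatrix_mulVec (x y : V → ℝ) :
    x ⬝ᵥ (G.adjMatrix ℝ).mulVec y = ∑ u, ∑ v, G.adjMatrix ℝ u v * (x u * y v) := by
  simp only [dotProduct, Matrix.mulVec, mul_sum]
  exact sum_congr rfl fun u _ => sum_congr rfl fun v _ => by ring

theorem sum_adjMatrix_eq_degree (u : V) : ∑ v, G.adjMatrix ℝ u v = G.degree u := by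
  simp [adjMatrix_apply, ← card_neighborFinset_eq_degree, neighborFinset_eq_filter]

variable [DecidableEq V]

theorem exists_adjSpectralRadius_eq [Nonempty V] :
    (∃ i, G.adjSpectralRadius = |(G.isHermitian_adjMatrix ℝ).eigenvalues i|) ∧
      ∀ i, |(G.isHermitian_adjMatrix ℝ).eigenvalues i| ≤ G.adjSpectralRadius := by
  set l := (G.isHermitian_adjMatrix ℝ).eigenvalues
  obtain ⟨j, -, hj⟩ := exists_max_image univ (fun i => |l i|) univ_nonempty
  have : G.adjSpectralRadius = |l j| := by
    have h : spectralRadius ℝ (G.adjMatrix ℝ) = (‖l j‖₊ : ENNReal) := by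
      rw [spectralRadius, (G.isHermitian_adjMatrix ℝ).spectrum_real_eq_range_eigenvalues, iSup_range]
      refine le_antisymm (iSup_le fun i => ?_) (le_iSup (fun i => (‖l i‖₊ : ENNReal)) j)
      exact_mod_cast hj i (mem_univ i)
    rw [adjSpectralRadius, h]
    simp
  exact ⟨⟨j, this⟩, fun i => this ▸ hj i (mem_univ i)⟩

/-- The spectral radius of a graph is an eigenvalue of its adjacency matrix. -/
theorem exists_eigenvalue_eq_adjSpectralRadius [Nonempty V] :
    ∃ i, (G.isHermitian_adjMatrix ℝ).eigenvalues i = G.adjSpectralRadius := by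
  set hA := G.isHermitian_adjMatrix ℝ
  obtain ⟨⟨j, hj⟩, hle⟩ := G.exists_adjSpectralRadius_eq
  obtain ⟨i, -, hi⟩ := exists_max_image univ hA.eigenvalues univ_nonempty
  refine ⟨i, le_antisymm ((le_abs_self _).trans (hle i)) ?_⟩
  obtain ⟨y, hyy, hq⟩ := hA.exists_dotProduct_mulVec_eq_eigenvalue j
  -- Perron–Frobenius argument: the entries of the matrix are nonnegative, so taking absolute values
  -- in an eigenvector cannot lower the modulus of its quadratic form.
  have habs := hA.dotProduct_mulVec_le (fun i' => hi i' (mem_univ i')) fun v => |y v|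
  have hyy' : (fun v => |y v|) ⬝ᵥ (fun v => |y v|) = 1 := by
    rw [← hyy]
    simp [dotProduct]
  rw [hyy', mul_one, dotProduct_adjMatrix_mulVec] at habs
  rw [hj, ← hq, dotProduct_adjMatrix_mulVec]
  refine (abs_sum_le_sum_abs _ _).trans ((sum_le_sum fun u _ => ?_).trans habs)
  refine (abs_sum_le_sum_abs _ _).trans (sum_le_sum fun v _ => ?_)
  rw [abs_mul, abs_mul]
  refine mul_le_mul_of_nonneg_right (le_of_eq (abs_of_nonneg ?_)) (by positivity)
  rw [adjMatrix_apply]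
  split_ifs <;> norm_num

/-- Test the quadratic form on the all-ones vector. -/
theorem minDegree_le_adjSpectralRadius [Nonempty V] : (G.minDegree : ℝ) ≤ G.adjSpectralRadius := by
  have h := (G.isHermitian_adjMatrix ℝ).dotProduct_mulVec_le
    (fun i => (le_abs_self _).trans (G.exists_adjSpectralRadius_eq.2 i)) fun _ => 1
  rw [dotProduct_adjMatrix_mulVec] at h
  simp only [mul_one, sum_adjMatrix_eq_degree] at h
  have h1 : ∑ _u : V, (G.minDegree : ℝ) ≤ ∑ u, (G.degree u : ℝ) :=
    sum_le_sum fun u _ => by exact_mod_cast G.minDegree_le_degree u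
  have hpos : (0 : ℝ) < Fintype.card V := by exact_mod_cast Fintype.card_pos
  simp [dotProduct] at h h1
  nlinarith

theorem adjSpectralRadius_le_maxDegree [Nonempty V] : G.adjSpectralRadius ≤ G.maxDegree := by
  set hA := G.isHermitian_adjMatrix ℝ
  obtain ⟨j, hj⟩ := G.exists_eigenvalue_eq_adjSpectralRadius
  obtain ⟨y, hyy, hq⟩ := hA.exists_dotProduct_mulVec_eq_eigenvalue j
  rw [← hj, ← hq, dotProduct_adjMatrix_mulVec]
  have h0 : ∀ u v, 0 ≤ G.adjMatrix ℝ u v := fun u v => by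
    rw [adjMatrix_apply]
    split_ifs <;> norm_num
  have h1 : ∑ u, ∑ v, G.adjMatrix ℝ u v * y u ^ 2 = ∑ u, G.degree u * y u ^ 2 := by
    simp_rw [← sum_mul, sum_adjMatrix_eq_degree]
  have h2 : ∑ u, ∑ v, G.adjMatrix ℝ u v * y v ^ 2 = ∑ u, G.degree u * y u ^ 2 := by
    rw [sum_comm, ← h1]
    exact sum_congr rfl fun u _ => sum_congr rfl fun v _ => by rw [(G.isSymm_adjMatrix).apply]
  calc ∑ u, ∑ v, G.adjMatrix ℝ u v * (y u * y v)
      ≤ ∑ u, ∑ v, (G.adjMatrix ℝ u v * y u ^ 2 + G.adjMatrix ℝ u v * y v ^ 2) / 2 :=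
        sum_le_sum fun u _ => sum_le_sum fun v _ => by
          nlinarith [mul_nonneg (h0 u v) (sq_nonneg (y u - y v))]
    _ = ∑ u, G.degree u * y u ^ 2 := by
        simp_rw [← sum_div, sum_add_distrib]
        rw [h1, h2]
        ring
    _ ≤ ∑ u, G.maxDegree * y u ^ 2 := sum_le_sum fun u _ =>
        mul_le_mul_of_nonneg_right (by exact_mod_cast G.degree_le_maxDegree u) (sq_nonneg _)
    _ = G.maxDegree := by
        rw [← mul_sum]
        simp only [dotProduct, ← sq] at hyy
        rw [hyy, mul_one]

end SimpleGraph

/-! ### Degree sums and the upper bound on edges -/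

namespace SimpleGraph

variable {V : Type*} (G : SimpleGraph V) [DecidableRel G.Adj]

theorem adjMatrix_nonneg (u v : V) : 0 ≤ G.adjMatrix ℝ u v := by
  rw [adjMatrix_apply]
  split_ifs <;> norm_num

theorem adjMatrix_le_one (u v : V) : G.adjMatrix ℝ u v ≤ 1 := by
  rw [adjMatrix_apply]
  split_ifs <;> norm_num

theorem adjMatrix_comm (u v : V) : G.adjMatrix ℝ u v = G.adjMatrix ℝ v u :=
  (G.isSymm_adjMatrix).apply v u

theorem sum_degree_eq [Fintype V] : ∑ u, (G.degree u : ℝ) = 2 * G.edgeFinset.card := by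
  classical
  exact_mod_cast G.sum_degrees_eq_twice_card_edges

theorem two_mul_edgesWithin [DecidableEq V] (S : Finset V) :
    2 * (G.edgesWithin S : ℝ) = ∑ u ∈ S, ∑ v ∈ S, G.adjMatrix ℝ u v := by
  rw [edgesWithin, ← sum_degree_eq]
  simp_rw [← sum_adjMatrix_eq_degree]
  rw [← sum_coe_sort S]
  refine sum_congr rfl fun u _ => ?_
  rw [← sum_coe_sort S]
  refine sum_congr rfl fun v _ => ?_
  simp [adjMatrix_apply]

variable [Fintype V]

/-- A Moon–Moser type inequality. -/
theorem two_mul_sum_degree_sq_le :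
    2 * ∑ u, (G.degree u : ℝ) ^ 2 - 2 * Fintype.card V * G.edgeFinset.card ≤
      G.orderedTriangles := by
  have key : ∀ u v, G.adjMatrix ℝ u v * (G.degree u + G.degree v - Fintype.card V) ≤
      ∑ w, G.adjMatrix ℝ u v * G.adjMatrix ℝ v w * G.adjMatrix ℝ w u := by
    intro u v
    simp_rw [mul_assoc, ← mul_sum]
    refine mul_le_mul_of_nonneg_left ?_ (G.adjMatrix_nonneg u v)
    have h : ∑ w, (G.adjMatrix ℝ u w + G.adjMatrix ℝ v w - 1) =
        G.degree u + G.degree v - Fintype.card V := by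
      rw [sum_sub_distrib, sum_add_distrib, sum_adjMatrix_eq_degree, sum_adjMatrix_eq_degree]
      simp
    rw [← h]
    refine sum_le_sum fun w _ => ?_
    rw [G.adjMatrix_comm w u]
    -- Pointwise inclusion–exclusion: $(1-x)(1-y)\ge0$ gives $x+y-1\le xy$.
    nlinarith [mul_nonneg (sub_nonneg.2 (G.adjMatrix_le_one u w))
      (sub_nonneg.2 (G.adjMatrix_le_one v w))]
  have h1 : ∑ u, ∑ v, G.adjMatrix ℝ u v * G.degree u = ∑ u, (G.degree u : ℝ) ^ 2 := by
    simp_rw [← sum_mul, sum_adjMatrix_eq_degree, sq]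
  have h2 : ∑ u, ∑ v, G.adjMatrix ℝ u v * G.degree v = ∑ u, (G.degree u : ℝ) ^ 2 := by
    rw [sum_comm, ← h1]
    exact sum_congr rfl fun u _ => sum_congr rfl fun v _ => by rw [G.adjMatrix_comm v u]
  have h3 : ∑ u, ∑ v, G.adjMatrix ℝ u v * Fintype.card V =
      2 * Fintype.card V * G.edgeFinset.card := by
    simp_rw [← sum_mul, sum_adjMatrix_eq_degree, sum_degree_eq]
    ring
  calc 2 * ∑ u, (G.degree u : ℝ) ^ 2 - 2 * Fintype.card V * G.edgeFinset.card
      = ∑ u, ∑ v, G.adjMatrix ℝ u v * (G.degree u + G.degree v - Fintype.card V) := by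
        simp only [mul_sub, mul_add, sum_sub_distrib, sum_add_distrib]
        rw [h1, h2, h3]
        ring
    _ ≤ G.orderedTriangles := sum_le_sum fun u _ => sum_le_sum fun v _ => key u v

theorem four_mul_card_edgeFinset_sq_le :
    4 * (G.edgeFinset.card : ℝ) ^ 2 ≤ Fintype.card V * ∑ u, (G.degree u : ℝ) ^ 2 := by
  have h := sq_sum_le_card_mul_sum_sq (s := univ) (f := fun u => (G.degree u : ℝ))
  rw [sum_degree_eq, card_univ] at h
  linarith

theorem card_edgeFinset_le_of_friendship_free [DecidableEq V] {k : ℕ}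
    (hfree : (friendshipGraph k).Free G) :
    (G.edgeFinset.card : ℝ) ≤ (Fintype.card V : ℝ) ^ 2 / 4 + 18 * k ^ 2 := by
  rcases isEmpty_or_nonempty V with hV | hV
  · have : G.edgeFinset.card = 0 := by
      have := G.sum_degrees_eq_twice_card_edges
      simp at this
      simpa using this
    rw [this]
    simp
  have hn : (0 : ℝ) < Fintype.card V := by exact_mod_cast Fintype.card_pos
  have h1 := G.two_mul_sum_degree_sq_le
  have h2 := G.four_mul_card_edgeFinset_sq_le
  have h3 := orderedTriangles_le hfree
  set n : ℝ := (Fintype.card V : ℝ)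
  set e : ℝ := (G.edgeFinset.card : ℝ)
  by_contra! hcon
  have h4 : 8 * e ^ 2 ≤ n * (2 * n * e + 36 * k ^ 2 * n) := by nlinarith
  have h5 : 0 ≤ (k : ℝ) ^ 2 := by positivity
  nlinarith [mul_pos hn hn, sq_nonneg (e - n ^ 2 / 4)]

/-! ### Traces and the lower bound on edges -/

theorem trace_adjMatrix_sq [DecidableEq V] :
    ((G.adjMatrix ℝ) ^ 2).trace = 2 * G.edgeFinset.card := by
  rw [← sum_degree_eq, sq, Matrix.trace]
  exact sum_congr rfl fun u _ => G.adjMatrix_mul_self_apply_self u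

theorem trace_adjMatrix_cube [DecidableEq V] :
    ((G.adjMatrix ℝ) ^ 3).trace = G.orderedTriangles := by
  simp only [pow_succ, pow_zero, one_mul, Matrix.trace, Matrix.diag, Matrix.mul_apply, sum_mul,
    orderedTriangles]
  exact sum_congr rfl fun u _ => sum_comm

/-- Every term $\lambda_j^2(\lambda_j+\mu)$ is nonnegative, and the top eigenvalue $\mu$ alone
contributes $2\mu^3$. -/
theorem two_mul_adjSpectralRadius_cube_le [DecidableEq V] [Nonempty V] :
    2 * G.adjSpectralRadius ^ 3 ≤
      G.orderedTriangles + 2 * G.edgeFinset.card * G.adjSpectralRadius := by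
  obtain ⟨i, hi⟩ := G.exists_eigenvalue_eq_adjSpectralRadius
  have hle := G.exists_adjSpectralRadius_eq.2
  set hA := G.isHermitian_adjMatrix ℝ
  rw [← trace_adjMatrix_cube, ← trace_adjMatrix_sq, hA.trace_pow_eq_sum, hA.trace_pow_eq_sum,
    sum_mul, ← sum_add_distrib]
  set μ := G.adjSpectralRadius
  have h : ∀ j, 0 ≤ hA.eigenvalues j ^ 3 + hA.eigenvalues j ^ 2 * μ := by
    intro j
    have := neg_le_of_abs_le (hle j)
    nlinarith [mul_nonneg (sq_nonneg (hA.eigenvalues j)) (show 0 ≤ hA.eigenvalues j + μ by linarith)]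
  calc 2 * μ ^ 3 = hA.eigenvalues i ^ 3 + hA.eigenvalues i ^ 2 * μ := by
        rw [hi]
        ring
    _ ≤ _ := single_le_sum (f := fun j => hA.eigenvalues j ^ 3 + hA.eigenvalues j ^ 2 * μ)
        (fun j _ => h j) (mem_univ i)

theorem le_card_edgeFinset_of_friendship_free [DecidableEq V] [Nonempty V] {k : ℕ}
    (hfree : (friendshipGraph k).Free G)
    (hspec : (Fintype.card V : ℝ) / 2 ≤ G.adjSpectralRadius) :
    (Fintype.card V : ℝ) ^ 2 / 4 - 36 * k ^ 2 ≤ G.edgeFinset.card := by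
  have hn : (0 : ℝ) < Fintype.card V := by exact_mod_cast Fintype.card_pos
  have h1 := G.two_mul_adjSpectralRadius_cube_le
  have h2 := orderedTriangles_le hfree
  set n : ℝ := (Fintype.card V : ℝ)
  set e : ℝ := (G.edgeFinset.card : ℝ)
  set μ := G.adjSpectralRadius
  have hμ : 0 < μ := by linarith
  have h3 : 36 * k ^ 2 * n ≤ 72 * k ^ 2 * μ := by
    nlinarith [show (0 : ℝ) ≤ (k : ℝ) ^ 2 by positivity]
  have h4 : μ ^ 2 - 36 * k ^ 2 ≤ e := by
    by_contra! hcon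
    nlinarith
  nlinarith

/-! ### A partition with few inner edges -/

theorem card_edgeFinset_eq_edgesWithin_add [DecidableEq V] (S : Finset V) :
    (G.edgeFinset.card : ℝ) = G.edgesWithin S + G.edgesWithin Sᶜ +
      ∑ u ∈ S, ∑ v ∈ Sᶜ, G.adjMatrix ℝ u v := by
  have h1 := G.two_mul_edgesWithin S
  have h2 := G.two_mul_edgesWithin Sᶜ
  have h3 := G.sum_degree_eq
  simp_rw [← sum_adjMatrix_eq_degree] at h3
  simp_rw [← sum_add_sum_compl S, sum_add_distrib] at h3
  have h4 : ∑ u ∈ Sᶜ, ∑ v ∈ S, G.adjMatrix ℝ u v = ∑ u ∈ S, ∑ v ∈ Sᶜ, G.adjMatrix ℝ u v := by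
    refine sum_comm.trans ?_
    exact sum_congr rfl fun u _ => sum_congr rfl fun v _ => G.adjMatrix_comm v u
  linarith

/-- The degree sum over $N(v)$ counts inner edges of $N(v)$ twice and crossing edges once; the
triangle sum at $v$ restores the inner edges. -/
theorem edgesWithin_neighborFinset_add [DecidableEq V] (v : V) :
    (G.edgesWithin (G.neighborFinset v) : ℝ) + G.edgesWithin (G.neighborFinset v)ᶜ =
      G.edgeFinset.card - ∑ u, G.adjMatrix ℝ v u * G.degree u +
        ∑ u, ∑ w, G.adjMatrix ℝ v u * G.adjMatrix ℝ u w * G.adjMatrix ℝ w v := by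
  set S := G.neighborFinset v with hS
  have h1 := G.two_mul_edgesWithin S
  have h2 := G.card_edgeFinset_eq_edgesWithin_add S
  have hsum : ∀ f : V → ℝ, ∑ u, G.adjMatrix ℝ v u * f u = ∑ u ∈ S, f u := by
    intro f
    rw [hS, neighborFinset_eq_filter, sum_filter]
    exact sum_congr rfl fun u _ => by simp [adjMatrix_apply]
  have h3 : ∑ u, G.adjMatrix ℝ v u * G.degree u =
      ∑ u ∈ S, ∑ w ∈ S, G.adjMatrix ℝ u w + ∑ u ∈ S, ∑ w ∈ Sᶜ, G.adjMatrix ℝ u w := by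
    rw [hsum, ← sum_add_distrib]
    exact sum_congr rfl fun u _ => by rw [sum_add_sum_compl, sum_adjMatrix_eq_degree]
  have h4 : ∑ u, ∑ w, G.adjMatrix ℝ v u * G.adjMatrix ℝ u w * G.adjMatrix ℝ w v =
      ∑ u ∈ S, ∑ w ∈ S, G.adjMatrix ℝ u w := by
    simp_rw [mul_assoc, ← mul_sum]
    rw [hsum]
    refine sum_congr rfl fun u _ => ?_
    rw [← hsum]
    exact sum_congr rfl fun w _ => by rw [G.adjMatrix_comm w v, mul_comm]
  rw [h3, h4]
  linarith

theorem exists_edgesWithin_add_le [DecidableEq V] [Nonempty V] :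
    ∃ S : Finset V, (Fintype.card V : ℝ) * ((G.edgesWithin S : ℝ) + G.edgesWithin Sᶜ) ≤
      Fintype.card V * G.edgeFinset.card - ∑ u, (G.degree u : ℝ) ^ 2 + G.orderedTriangles := by
  obtain ⟨v, -, hv⟩ := exists_min_image univ (fun v => (G.edgesWithin (G.neighborFinset v) : ℝ) +
    G.edgesWithin (G.neighborFinset v)ᶜ) univ_nonempty
  refine ⟨G.neighborFinset v, ?_⟩
  have h1 := card_nsmul_le_sum univ _ _ hv
  have h2 : ∑ v, ∑ u, G.adjMatrix ℝ v u * G.degree u = ∑ u, (G.degree u : ℝ) ^ 2 := by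
    rw [sum_comm]
    refine sum_congr rfl fun u _ => ?_
    simp_rw [← sum_mul, G.adjMatrix_comm _ u, sum_adjMatrix_eq_degree, sq]
  simp_rw [edgesWithin_neighborFinset_add, sum_add_distrib, sum_sub_distrib] at h1
  rw [h2] at h1
  rw [edgesWithin_neighborFinset_add]
  rw [card_univ, nsmul_eq_mul, sum_const, card_univ, nsmul_eq_mul] at h1
  exact h1

/-! ### Degree bounds -/

/-- If `G` has no friendship subgraph and `v` has many neighbours both in `S` and outside `S`, then
many pairs between `S` and its complement are not adjacent. -/
theorem exists_degree_split_sum_adjMatrix_compl_le [DecidableEq V] {k : ℕ} (hfree : (friendshipGraph k).Free G)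
    (S : Finset V) (v : V) :
    ∃ a b : ℝ, a + b = G.degree v ∧ a ≤ S.card ∧ b ≤ Sᶜ.card ∧ (k ≤ a → k ≤ b →
      ∑ u ∈ S, ∑ w ∈ Sᶜ, G.adjMatrix ℝ u w ≤ S.card * Sᶜ.card - (a - k) * (b - k)) := by
  set N := G.neighborFinset v
  obtain ⟨A, B, hA, hB, hA', hB', hcov⟩ := exists_cover_of_not_hasDisjointPairs
    (r := fun x y => (x ∈ S ∧ y ∈ Sᶜ) ∧ G.Adj v x ∧ G.Adj v y ∧ G.Adj x y)
    (fun x hx => hx.2.2.2.ne rfl) (not_hasDisjointPairs_of_free hfree v fun _ _ h => h.2)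
  refine ⟨(S ∩ N).card, (Sᶜ ∩ N).card, ?_, by exact_mod_cast card_le_card inter_subset_left,
    by exact_mod_cast card_le_card inter_subset_left, fun ha hb => ?_⟩
  · rw [← card_neighborFinset_eq_degree, inter_comm, inter_comm Sᶜ, ← sdiff_eq_inter_compl]
    exact_mod_cast card_inter_add_card_sdiff N S
  -- Related pairs go from `S` to `Sᶜ`, so `A` lies in `S` and `B` in `Sᶜ`: each side loses only `k`
  -- points, and no edge joins `X` to `Y`.
  set X := (S ∩ N) \ A
  set Y := (Sᶜ ∩ N) \ B
  have hX : ((S ∩ N).card : ℝ) - k ≤ X.card := by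
    have h0 : (S ∩ N).card - A.card ≤ X.card := le_card_sdiff A (S ∩ N)
    have h : (S ∩ N).card ≤ X.card + k := by omega
    have : ((S ∩ N).card : ℝ) ≤ X.card + k := by exact_mod_cast h
    linarith
  have hY : ((Sᶜ ∩ N).card : ℝ) - k ≤ Y.card := by
    have h0 : (Sᶜ ∩ N).card - B.card ≤ Y.card := le_card_sdiff B (Sᶜ ∩ N)
    have h : (Sᶜ ∩ N).card ≤ Y.card + k := by omega
    have : ((Sᶜ ∩ N).card : ℝ) ≤ Y.card + k := by exact_mod_cast h
    linarith
  have hpt : ∀ u ∈ S, ∀ w ∈ Sᶜ, G.adjMatrix ℝ u w ≤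
      1 - (if u ∈ X then 1 else 0) * (if w ∈ Y then 1 else 0) := by
    intro u hu w hw
    by_cases h1 : u ∈ X; swap
    · simpa [h1] using G.adjMatrix_le_one u w
    by_cases h2 : w ∈ Y; swap
    · simpa [h2] using G.adjMatrix_le_one u w
    have : ¬ G.Adj u w := by
      intro hadj
      simp only [X, Y, N, mem_sdiff, mem_inter, mem_neighborFinset, mem_compl] at h1 h2
      rcases hcov u w ⟨⟨hu, hw⟩, h1.1.2, h2.1.2, hadj⟩ with h | h | h | h
      · exact h1.2 h
      · obtain ⟨x, hx⟩ := hB' _ h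
        exact mem_compl.1 hx.1.2 hu
      · obtain ⟨x, hx⟩ := hA' _ h
        exact mem_compl.1 hw hx.1.1
      · exact h2.2 h
    simp [h1, h2, this]
  calc ∑ u ∈ S, ∑ w ∈ Sᶜ, G.adjMatrix ℝ u w
      ≤ ∑ u ∈ S, ∑ w ∈ Sᶜ, (1 - (if u ∈ X then 1 else 0) * (if w ∈ Y then (1 : ℝ) else 0)) :=
        sum_le_sum fun u hu => sum_le_sum fun w hw => hpt u hu w hw
    _ = S.card * Sᶜ.card - X.card * Y.card := by
        have hXS : S ∩ X = X := inter_eq_right.2 fun x hx => by simp_all [X]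
        have hYS : Sᶜ ∩ Y = Y := inter_eq_right.2 fun x hx => by simp_all [Y]
        simp only [sum_sub_distrib, ← sum_mul_sum, sum_ite_mem, hXS, hYS]
        simp
    _ ≤ _ := by
        have := mul_le_mul hX hY (by linarith) (by positivity)
        linarith

/-- Deleting a vertex of minimum degree leaves at most $(n-1)^2/4+18k^2$ edges, so $\delta\ge
n/2-1/4-54k^2$. -/
theorem lt_minDegree [DecidableEq V] [Nonempty V] {k : ℕ} (hk : 1 ≤ k)
    (hfree : (friendshipGraph k).Free G)
    (he : (Fintype.card V : ℝ) ^ 2 / 4 - 36 * k ^ 2 ≤ G.edgeFinset.card) :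
    (Fintype.card V : ℝ) / 2 - 56 * k ^ 2 < G.minDegree := by
  obtain ⟨v, hv⟩ := G.exists_minimal_degree_vertex
  have hfree' : (friendshipGraph k).Free (G.induce {v}ᶜ) := fun h =>
    hfree (h.trans ⟨Copy.induce G {v}ᶜ⟩)
  have h1 := (G.induce {v}ᶜ).card_edgeFinset_le_of_friendship_free hfree'
  rw [card_edgeFinset_induce_compl_singleton, card_edgeFinset_deleteIncidenceSet] at h1
  have h2 : (Fintype.card ↥({v}ᶜ : Set V) : ℝ) = Fintype.card V - 1 := by
    rw [Fintype.card_compl_set]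
    simp [Nat.cast_sub (Fintype.card_pos (α := V))]
  have h3 : G.degree v ≤ G.edgeFinset.card := by
    rw [← card_incidenceFinset_eq_degree]
    exact card_le_card (G.incidenceFinset_subset v)
  rw [Nat.cast_sub h3, h2, ← hv] at h1
  have hk' : (1 : ℝ) ≤ (k : ℝ) ^ 2 := by exact_mod_cast Nat.one_le_pow _ _ hk
  nlinarith

end SimpleGraph

/-! ### Assembling the bounds -/

theorem mainTheorem6 {V : Type*} [Fintype V] [DecidableEq V]
    (G : SimpleGraph V) [DecidableRel G.Adj] (n k : ℕ) (hn : Fintype.card V = n) (hk : 1 ≤ k)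
    (hfree : (friendshipGraph k).Free G)
    (hspec : (n : ℝ) / 2 ≤ G.adjSpectralRadius) :
    ((G.edgeFinset.card : ℝ) > (n : ℝ) ^ 2 / 4 - 54 * (k : ℝ) ^ 2) ∧
    (∃ S T : Finset V, Disjoint S T ∧ S ∪ T = Finset.univ ∧
      ((G.edgesWithin S : ℝ) + (G.edgesWithin T : ℝ) < 108 * (k : ℝ) ^ 2) ∧
      ((n : ℝ) / 2 - 13 * (k : ℝ) < (S.card : ℝ) ∧
        (S.card : ℝ) < (n : ℝ) / 2 + 13 * (k : ℝ)) ∧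
      ((n : ℝ) / 2 - 13 * (k : ℝ) < (T.card : ℝ) ∧
        (T.card : ℝ) < (n : ℝ) / 2 + 13 * (k : ℝ))) ∧
    ((n : ℝ) / 2 - 56 * (k : ℝ) ^ 2 < (G.minDegree : ℝ) ∧
      (G.minDegree : ℝ) ≤ G.adjSpectralRadius ∧
      G.adjSpectralRadius ≤ (G.maxDegree : ℝ) ∧
      (G.maxDegree : ℝ) < (n : ℝ) / 2 + 14 * (k : ℝ)) := by
  subst hn
  have hk1 : (1 : ℝ) ≤ k := by exact_mod_cast hk
  rcases isEmpty_or_nonempty V with hV | hV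
  · have hA : G.adjMatrix ℝ = 0 := Subsingleton.elim _ _
    have hrad : G.adjSpectralRadius = 0 := by
      rw [SimpleGraph.adjSpectralRadius, hA, spectralRadius]
      simp [spectrum.of_subsingleton]
    have hmax : G.maxDegree = 0 := by simp
    have hmin : G.minDegree = 0 := by simp
    have h2 := G.two_mul_edgesWithin ∅
    simp at h2
    rw [hrad, hmax, hmin]
    refine ⟨?_, ⟨∅, ∅, by simp, Subsingleton.elim _ _, ?_, ?_, ?_⟩, ?_⟩
    · have : (0 : ℝ) ≤ G.edgeFinset.card := by positivity
      simp only [Fintype.card_eq_zero, Nat.cast_zero]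
      nlinarith
    · rw [h2]
      norm_num
      nlinarith
    all_goals simp
    all_goals first | nlinarith | (constructor <;> nlinarith)
  have hpos : (0 : ℝ) < Fintype.card V := by exact_mod_cast Fintype.card_pos
  have he := G.le_card_edgeFinset_of_friendship_free hfree hspec
  obtain ⟨S, hS⟩ := G.exists_edgesWithin_add_le
  have hT := orderedTriangles_le hfree
  have hsq := G.four_mul_card_edgeFinset_sq_le
  have hsplit := G.card_edgeFinset_eq_edgesWithin_add S
  have hcard : (S.card : ℝ) + Sᶜ.card = Fintype.card V := by
    exact_mod_cast S.card_add_card_compl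
  have hmin := G.lt_minDegree hk hfree he
  have hdel := G.minDegree_le_adjSpectralRadius
  have hDel := G.adjSpectralRadius_le_maxDegree
  obtain ⟨v, hv⟩ := G.exists_maximal_degree_vertex
  obtain ⟨a, b, hab, haS, hbS, hcross⟩ := G.exists_degree_split_sum_adjMatrix_compl_le hfree S v
  have hcross' : ∑ u ∈ S, ∑ w ∈ Sᶜ, G.adjMatrix ℝ u w ≤ S.card * Sᶜ.card := by
    calc _ ≤ ∑ u ∈ S, ∑ w ∈ Sᶜ, (1 : ℝ) :=
          Finset.sum_le_sum fun u _ => Finset.sum_le_sum fun w _ => G.adjMatrix_le_one u w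
      _ = _ := by simp
  set n : ℝ := (Fintype.card V : ℝ)
  set e : ℝ := (G.edgeFinset.card : ℝ)
  set K : ℝ := (k : ℝ)
  set h : ℝ := (G.edgesWithin S : ℝ) + G.edgesWithin Sᶜ
  set s : ℝ := (S.card : ℝ)
  set t : ℝ := (Sᶜ.card : ℝ)
  -- Insert $\sum d^2\ge4e^2/n$ in the averaged bound: triangles contribute $36k^2$, and the edge
  -- deficit $n^2-4e\le144k^2$ another $36k^2$.
  have hh : h ≤ 72 * K ^ 2 := by
    have h1 : n ^ 2 * h ≤ e * (n ^ 2 - 4 * e) + 36 * K ^ 2 * n ^ 2 := by nlinarith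
    have h2 : e * (n ^ 2 - 4 * e) ≤ 36 * K ^ 2 * n ^ 2 := by
      have he0 : 0 ≤ e := Nat.cast_nonneg _
      rcases le_total (n ^ 2) (4 * e) with hc | hc
      · nlinarith [mul_nonneg he0 (sub_nonneg.2 hc), mul_nonneg (sq_nonneg K) (sq_nonneg n)]
      · nlinarith [mul_le_mul_of_nonneg_left (show n ^ 2 - 4 * e ≤ 144 * K ^ 2 by linarith) he0,
          mul_le_mul_of_nonneg_right hc (sq_nonneg K)]
    have h3 : 0 < n ^ 2 := by positivity
    by_contra! hcon
    nlinarith [mul_lt_mul_of_pos_left hcon h3]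
  have hK : 1 ≤ K ^ 2 := one_le_pow₀ hk1
  have hprod : s * t = n ^ 2 / 4 - (s - n / 2) ^ 2 := by
    rw [show t = n - s by linarith]
    ring
  -- $108=36+72$: the edge deficit plus the inner edges. Then $108<13^2$ gives the radius $13k$.
  have hst : (s - n / 2) ^ 2 ≤ 108 * K ^ 2 := by linarith
  have hs := abs_lt_of_sq_lt_sq' (show (s - n / 2) ^ 2 < (13 * K) ^ 2 by rw [mul_pow]; linarith) (by linarith)
  refine ⟨by linarith, ⟨S, Sᶜ, disjoint_compl_right, Finset.union_compl S, ?_, ?_, ?_⟩,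
    hmin, hdel, hDel, ?_⟩
  · change h < _
    linarith
  · constructor <;> linarith
  · constructor <;> linarith
  · by_contra! hcon
    rw [hv, ← hab] at hcon
    -- From $a+b\ge n/2+14k$ with $b\le t=n-s$, and symmetrically. The missing pairs then leave at
    -- most $n^2/4-169k^2$ crossing edges, fewer than the $n^2/4-108k^2$ present.
    have ha : 13 * K + (s - n / 2) ≤ a - K := by linarith
    have hb : 13 * K - (s - n / 2) ≤ b - K := by linarith
    have := hcross (by linarith) (by linarith)
    have := mul_le_mul ha hb (by linarith) (by linarith)
    have hdiff : (13 * K + (s - n / 2)) * (13 * K - (s - n / 2)) =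
        169 * K ^ 2 - (s - n / 2) ^ 2 := by ring
    linarith
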